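/- Let $A \subseteq \mathbb{R}^d$ be a nonempty closed convex set, let $Y$ be a real Banach space with topological dual $Y^*$, let $K \subset Y$ be a nonempty closed convex cone with polar cone $K^* = \{ y^* \in Y^* \mid \langle y^*, y \rangle \le 0 \ \forall y \in K \}$, let $W$ be a nonempty compact Hausdorff space, and let $f \colon \mathbb{R}^d \times W \to \mathbb{R}$ and $G \colon \mathbb{R}^d \to Y$. Suppose that for every $x \in \mathbb{R}^d$ the maximum $F(x) = \max_{\omega \in W} f(x, \omega)$ is attained (as is the case when $f(x, \cdot)$ is continuous), and consider the problem $$ (\mathcal{P}) \qquad \min F(x) \quad \text{subject to} \quad G(x) \in K, \quad x \in A . $$ Let $x_*$ be a feasible point of $(\mathcal{P})$. Suppose that on some open neighbourhood $U$ of $x_*$ the function $f(x,\omega)$ is differentiable in $x$ for every $\omega \in W$, $f$ and $\nabla_x f$ are jointly continuous on $U \times W$, and $G$ is continuously Fréchet differentiable on $U$. Suppose also that $f(\cdot, \omega)$ is convex on $\mathbb{R}^d$ for every $\omega \in W$ and that $G$ is $(-K)$-convex, i.e. $G(\alpha x_1 + (1 - \alpha) x_2) - \alpha G(x_1) - (1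 - \alpha) G(x_2) \in K$ for all $x_1, x_2 \in \mathbb{R}^d$ and $\alpha \in [0,1]$. Put $L(x, \lambda) = F(x) + \langle \lambda, G(x) \rangle$ for $x \in \mathbb{R}^d$, $\lambda \in Y^*$. Let $T_A(x_*)$ be the contingent cone to $A$ at $x_*$, that is, the set of all $h \in \mathbb{R}^d$ for which there are $\alpha_n > 0$ with $\alpha_n \to 0$ and $h_n \to h$ such that $x_* + \alpha_n h_n \in A$ for all $n \in \mathbb{N}$. A vector $\lambda_* \in Y^*$ is called a Lagrange multiplier of $(\mathcal{P})$ at $x_*$ if $\lambda_* \in K^*$, $\langle \lambda_*, G(x_*) \rangle = 0$, and for every $h \in T_A(x_*)$ the one-sided directional derivative $[L(\cdot, \lambda_*)]'(x_*, h)$ exists and is nonnegative. Then: 1. A vector $\lambda_* \in K^*$ is a Lagrange multiplier of $(\mathcal{P})$ at $x_*$ if and only if $(x_*, \lambda_*)$ is a global saddle point of the Lagrangian $L$, that is, $$ L(x, \lambda_*) \ge F(x_*) \ge L(x_*, \lambda) \qquad \forall x \in A, \ \lambda \in K^* . $$ 2. If a Lagrange multiplier of $(\mathcal{P})$ at $x_*$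 exists, then $x_*$ is a globally optimal solution of $(\mathcal{P})$. Conversely, if $x_*$ is a globally optimal solution of $(\mathcal{P})$ and Slater's condition $0 \in \operatorname{int}\{ G(A) - K \}$ holds, then a Lagrange multiplier of $(\mathcal{P})$ at $x_*$ exists. -/

import Mathlib

open Set Filter Topology
open scoped Pointwise

noncomputable section

namespace ConeMinimax

/-- The contingent (Bouligand tangent) cone to the set `C` at the point `x`. -/
def contingentCone {X : Type*} [NormedAddCommGroup X] [NormedSpace ℝ X] (C : Set X) (x : X) :
    Set X :=
  {h | ∃ (α : ℕ → ℝ) (v : ℕ → X), (∀ n, 0 < α n) ∧ Tendsto α atTop (𝓝 0) ∧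
    Tendsto v atTop (𝓝 h) ∧ ∀ n, x + α n • v n ∈ C}

/-- `φ` has the (one-sided) directional derivative `D` at `x` in the direction `h`. -/
def HasDirDeriv {X : Type*} [NormedAddCommGroup X] [NormedSpace ℝ X] (φ : X → ℝ) (x h : X)
    (D : ℝ) : Prop :=
  Tendsto (fun α : ℝ => (φ (x + α • h) - φ x) / α) (𝓝[>] 0) (𝓝 D)

section Problem

variable {d : ℕ} {W : Type*} {Y : Type*} [NormedAddCommGroup Y] [NormedSpace ℝ Y]

/-- The polar cone `K* = {y* ∈ Y* | ⟨y*, y⟩ ≤ 0 for all y ∈ K}` in the topological dual. -/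
def polarCone (K : ConvexCone ℝ Y) : Set (StrongDual ℝ Y) :=
  {l | ∀ y ∈ K, l y ≤ 0}

/-- `G` is convex with respect to the cone `-K`. -/
def IsNegConeConvex (K : ConvexCone ℝ Y) (G : EuclideanSpace ℝ (Fin d) → Y) : Prop :=
  ∀ x₁ x₂ : EuclideanSpace ℝ (Fin d), ∀ α ∈ Icc (0 : ℝ) 1,
    G (α • x₁ + (1 - α) • x₂) - α • G x₁ - (1 - α) • G x₂ ∈ K

/-- The objective `F x = max_ω f (x, ω)`, written as a supremum (which is a maximum as soon as
the maximum is attained). -/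
def objective (f : EuclideanSpace ℝ (Fin d) → W → ℝ) (x : EuclideanSpace ℝ (Fin d)) : ℝ :=
  ⨆ ω, f x ω

/-- The feasible region of the problem: minimise `F x` subject to `G x ∈ K`, `x ∈ A`. -/
def feasibleSet (A : Set (EuclideanSpace ℝ (Fin d))) (K : ConvexCone ℝ Y)
    (G : EuclideanSpace ℝ (Fin d) → Y) : Set (EuclideanSpace ℝ (Fin d)) :=
  {x | x ∈ A ∧ G x ∈ K}

/-- The Lagrangian `L (x, l) = F x + ⟨l, G x⟩`. -/
def lagrangian (f : EuclideanSpace ℝ (Fin d) → W → ℝ) (G : EuclideanSpace ℝ (Fin d) → Y)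
    (x : EuclideanSpace ℝ (Fin d)) (l : StrongDual ℝ Y) : ℝ :=
  objective f x + l (G x)

/-- `l` is a Lagrange multiplier of the problem at the point `x`: it lies in the polar cone,
satisfies complementary slackness, and the directional derivative of `L (·, l)` at `x` exists and
is nonnegative in every direction of the contingent cone to `A` at `x`. -/
def IsLagrangeMultiplier (A : Set (EuclideanSpace ℝ (Fin d))) (K : ConvexCone ℝ Y)
    (f : EuclideanSpace ℝ (Fin d) → W → ℝ) (G : EuclideanSpace ℝ (Fin d) → Y)
    (x : EuclideanSpace ℝ (Fin d)) (l : StrongDual ℝ Y) : Prop :=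
  l ∈ polarCone K ∧ l (G x) = 0 ∧
    ∀ h ∈ contingentCone A x, ∃ D : ℝ, HasDirDeriv (fun z => lagrangian f G z l) x h D ∧ 0 ≤ D

/-- `(x, l)` is a global saddle point of the Lagrangian (on `A` and the polar cone of `K`). -/
def IsGlobalSaddlePoint (A : Set (EuclideanSpace ℝ (Fin d))) (K : ConvexCone ℝ Y)
    (f : EuclideanSpace ℝ (Fin d) → W → ℝ) (G : EuclideanSpace ℝ (Fin d) → Y)
    (x : EuclideanSpace ℝ (Fin d)) (l : StrongDual ℝ Y) : Prop :=
  ∀ z ∈ A, ∀ m ∈ polarCone K,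
    objective f x ≤ lagrangian f G z l ∧ lagrangian f G x m ≤ objective f x

/-- `x` is a globally optimal solution of the problem. -/
def IsGloballyOptimal (A : Set (EuclideanSpace ℝ (Fin d))) (K : ConvexCone ℝ Y)
    (f : EuclideanSpace ℝ (Fin d) → W → ℝ) (G : EuclideanSpace ℝ (Fin d) → Y)
    (x : EuclideanSpace ℝ (Fin d)) : Prop :=
  x ∈ feasibleSet A K G ∧ ∀ z ∈ feasibleSet A K G, objective f x ≤ objective f z

/-- Slater's condition `0 ∈ int (G(A) - K)`. -/
def SlaterCondition (A : Set (EuclideanSpace ℝ (Fin d))) (K : ConvexCone ℝ Y)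
    (G : EuclideanSpace ℝ (Fin d) → Y) : Prop :=
  (0 : Y) ∈ interior (G '' A - (K : Set Y))

end Problem

end ConeMinimax

end

namespace ConeMinimax

/-! ### Directional derivatives of convex functions -/

section ConvexFunctions

variable {X : Type*} [NormedAddCommGroup X] [NormedSpace ℝ X]

/-! For `l` in the polar cone, `l ∘ G` is convex, so the Lagrangian is convex in `x`. Its
directional derivatives bound increments from below, so the first-order condition over the
contingent cone of the convex set `A` is equivalent to global minimality over `A`; with
complementary slackness this is the saddle inequality, which in turn gives optimality.

For existence of a multiplier, optimality keeps `0` out of the strict epigraph of the perturbed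
value function, a convex subset of `Y × ℝ`. Separating `0` from its interior gives a functional, and
Slater's condition makes its real coefficient nonzero, so it can be normalised. As `Y` may be
infinite-dimensional, the interior must be shown nonempty: a Baire argument covers the Slater
neighbourhood by countably many sets, closed because balls in `ℝ^d` are compact. -/

lemma convexOn_comp_line {φ : X → ℝ} (hφ : ConvexOn ℝ univ φ) (x h : X) :
    ConvexOn ℝ univ (fun s : ℝ => φ (x + s • h)) := by
  refine ⟨convex_univ, fun s _ t _ a b ha hb hab => ?_⟩
  have key := hφ.2 (mem_univ (x + s • h)) (mem_univ (x + t • h)) ha hb hab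
  have e : x + (a • s + b • t) • h = a • (x + s • h) + b • (x + t • h) := by
    obtain rfl : b = 1 - a := by linarith
    simp only [smul_eq_mul]
    module
  simpa only [e] using key

/-- A convex function has one-sided directional derivatives. -/
lemma exists_hasDirDeriv {φ : X → ℝ} (hφ : ConvexOn ℝ univ φ) (x h : X) :
    ∃ D, HasDirDeriv φ x h D := by
  have hd := (convexOn_comp_line hφ x h).hasDerivWithinAt_sInf_slope_of_mem_interior
    (x := 0) (by simp)
  rw [hasDerivWithinAt_iff_tendsto_slope' self_notMem_Ioi] at hd
  refine ⟨_, hd.congr fun s => ?_⟩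
  simp [slope_def_field]

lemma hasDirDeriv_le_sub {φ : X → ℝ} (hφ : ConvexOn ℝ univ φ) {x z : X} {D : ℝ}
    (hD : HasDirDeriv φ x (z - x) D) : D ≤ φ z - φ x := by
  refine le_of_tendsto hD ?_
  filter_upwards [Ioo_mem_nhdsGT (zero_lt_one (α := ℝ))] with s hs
  have key := hφ.2 (mem_univ z) (mem_univ x) hs.1.le (by linarith [hs.2] : 0 ≤ 1 - s) (by ring)
  have e : s • z + (1 - s) • x = x + s • (z - x) := by module
  rw [e] at key
  rw [div_le_iff₀ hs.1]
  simp only [smul_eq_mul] at key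
  linarith

/-- At a minimiser over `A`, directional derivatives of a locally Lipschitz function are
nonnegative along the contingent cone. -/
lemma hasDirDeriv_nonneg_of_isMinOn {φ : X → ℝ} (hφ : LocallyLipschitz φ) {A : Set X} {x h : X}
    {D : ℝ} (hmin : ∀ z ∈ A, φ x ≤ φ z) (hh : h ∈ contingentCone A x)
    (hD : HasDirDeriv φ x h D) : 0 ≤ D := by
  obtain ⟨α, v, hα, hα0, hv, hmem⟩ := hh
  obtain ⟨C, V, hV, hLip⟩ := hφ x
  have hα' : Tendsto α atTop (𝓝[>] 0) :=
    tendsto_nhdsWithin_iff.2 ⟨hα0, Eventually.of_forall hα⟩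
  have h1 : Tendsto (fun n => x + α n • v n) atTop (𝓝 x) := by
    simpa using tendsto_const_nhds.add (hα0.smul hv)
  have h2 : Tendsto (fun n => x + α n • h) atTop (𝓝 x) := by
    simpa using tendsto_const_nhds.add (hα0.smul (tendsto_const_nhds (x := h)))
  have h3 : Tendsto (fun n => -(C * ‖v n - h‖)) atTop (𝓝 0) := by
    have := ((hv.sub_const h).norm.const_mul (C : ℝ)).neg
    simpa using this
  -- Minimality controls `φ` at `x + α n • v n`; passing to `x + α n • h` costs at most `C * α n *
  -- ‖v n - h‖`, which is `o(α n)`.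
  refine le_of_tendsto_of_tendsto h3 (hD.comp hα') ?_
  filter_upwards [h1 hV, h2 hV] with n hn1 hn2
  have hl := hLip.dist_le_mul _ hn1 _ hn2
  have e : (x + α n • v n) - (x + α n • h) = α n • (v n - h) := by module
  rw [Real.dist_eq, dist_eq_norm, e, norm_smul, Real.norm_of_nonneg (hα n).le] at hl
  have := (abs_le.1 hl).2
  have := hmin _ (hmem n)
  simp only [Function.comp_apply]
  rw [le_div_iff₀ (hα n)]
  linarith

lemma sub_mem_contingentCone {A : Set X} (hA : Convex ℝ A) {x z : X} (hx : x ∈ A) (hz : z ∈ A) :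
    z - x ∈ contingentCone A x := by
  refine ⟨fun n => 1 / ((n : ℝ) + 1), fun _ => z - x, fun n => by positivity,
    tendsto_one_div_add_atTop_nhds_zero_nat, tendsto_const_nhds, fun n => ?_⟩
  refine hA.add_smul_sub_mem hx hz ⟨by positivity, ?_⟩
  rw [div_le_one (by positivity)]
  linarith [(Nat.cast_nonneg n : (0 : ℝ) ≤ n)]

end ConvexFunctions

/-! ### Polar cones -/

section Cones

variable {Y : Type*} [NormedAddCommGroup Y] [NormedSpace ℝ Y] {K : ConvexCone ℝ Y}

lemma zero_mem_of_isClosed (hne : (K : Set Y).Nonempty) (hK : IsClosed (K : Set Y)) :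
    (0 : Y) ∈ K := by
  obtain ⟨k, hk⟩ := hne
  have ht : Tendsto (fun n : ℕ => (1 / ((n : ℝ) + 1)) • k) atTop (𝓝 0) := by
    simpa using (tendsto_one_div_add_atTop_nhds_zero_nat (𝕜 := ℝ)).smul_const k
  exact hK.mem_of_tendsto ht (Eventually.of_forall fun n => K.smul_mem (by positivity) hk)

lemma smul_mem_of_nonneg (h0 : (0 : Y) ∈ K) {a : ℝ} (ha : 0 ≤ a) {y : Y} (hy : y ∈ K) :
    a • y ∈ K := by
  rcases ha.eq_or_lt with rfl | ha
  · simpa using h0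
  · exact K.smul_mem ha hy

lemma nonpos_of_bddAbove_on_cone {l : StrongDual ℝ Y} {u : ℝ} (h : ∀ y ∈ K, l y ≤ u) :
    l ∈ polarCone K := by
  intro y hy
  by_contra! hpos
  obtain ⟨n, hn⟩ := exists_nat_gt (u / l y)
  have h1 := h _ (K.smul_mem (show (0 : ℝ) < n + 1 by positivity) hy)
  rw [map_smul, smul_eq_mul] at h1
  rw [div_lt_iff₀ hpos] at hn
  linarith

/-- The bipolar theorem for a closed convex cone. -/
lemma mem_iff_forall_polarCone (hne : (K : Set Y).Nonempty) (hK : IsClosed (K : Set Y)) (y : Y) :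
    y ∈ K ↔ ∀ l ∈ polarCone K, l y ≤ 0 := by
  refine ⟨fun hy l hl => hl y hy, fun h => ?_⟩
  by_contra hy
  obtain ⟨l, u, hl, hu⟩ := geometric_hahn_banach_closed_point K.convex hK hy
  have h0 := hl 0 (zero_mem_of_isClosed hne hK)
  have := h l (nonpos_of_bddAbove_on_cone fun k hk => (hl k hk).le)
  simp only [map_zero] at h0
  linarith

end Cones

/-! ### Saddle points and the multiplier rule -/

section Problem

variable {d : ℕ} {W : Type*} {Y : Type*} [NormedAddCommGroup Y] [NormedSpace ℝ Y]
  {A : Set (EuclideanSpace ℝ (Fin d))} {K : ConvexCone ℝ Y}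
  {f : EuclideanSpace ℝ (Fin d) → W → ℝ} {G : EuclideanSpace ℝ (Fin d) → Y}
  {xs : EuclideanSpace ℝ (Fin d)}

lemma convexOn_objective (hmax : ∀ x, ∃ ω, ∀ ω', f x ω' ≤ f x ω)
    (hf : ∀ ω, ConvexOn ℝ univ (fun x => f x ω)) : ConvexOn ℝ univ (objective f) := by
  refine ⟨convex_univ, fun x _ y _ a b ha hb hab => ?_⟩
  have hle : ∀ z ω, f z ω ≤ objective f z := fun z ω => by
    obtain ⟨ω₀, h₀⟩ := hmax z
    exact le_ciSup (f := f z) ⟨f z ω₀, by rintro _ ⟨ω', rfl⟩; exact h₀ ω'⟩ ω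
  obtain ⟨ω₀, -⟩ := hmax x
  have : Nonempty W := ⟨ω₀⟩
  refine ciSup_le fun ω => ((hf ω).2 (mem_univ x) (mem_univ y) ha hb hab).trans ?_
  have h1 := hle x ω
  have h2 := hle y ω
  simp only [smul_eq_mul]
  gcongr

lemma convexOn_polar_comp (hG : IsNegConeConvex K G) {l : StrongDual ℝ Y}
    (hl : l ∈ polarCone K) : ConvexOn ℝ univ (fun x => l (G x)) := by
  refine ⟨convex_univ, fun x _ y _ a b ha hb hab => ?_⟩
  obtain rfl : b = 1 - a := by linarith
  have := hl _ (hG x y a ⟨ha, by linarith⟩)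
  simp only [map_sub, map_smul] at this
  linarith

lemma convexOn_lagrangian (hF : ConvexOn ℝ univ (objective f)) (hG : IsNegConeConvex K G)
    {l : StrongDual ℝ Y} (hl : l ∈ polarCone K) :
    ConvexOn ℝ univ (fun x => lagrangian f G x l) :=
  hF.add (convexOn_polar_comp hG hl)

theorem isLagrangeMultiplier_iff_isGlobalSaddlePoint (hA : Convex ℝ A)
    (hxs : xs ∈ feasibleSet A K G) (hF : ConvexOn ℝ univ (objective f))
    (hG : IsNegConeConvex K G) {l : StrongDual ℝ Y} (hl : l ∈ polarCone K) :
    IsLagrangeMultiplier A K f G xs l ↔ IsGlobalSaddlePoint A K f G xs l := by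
  have hL := convexOn_lagrangian hF hG hl
  constructor
  · rintro ⟨-, hcs, hdir⟩ z hz m hm
    constructor
    · obtain ⟨D, hD, hD0⟩ := hdir _ (sub_mem_contingentCone hA hxs.1 hz)
      have := hasDirDeriv_le_sub hL hD
      simp only [lagrangian, hcs] at this ⊢
      linarith
    · have := hm _ hxs.2
      simp only [lagrangian]
      linarith
  · intro h
    have hcs : l (G xs) = 0 := by
      refine le_antisymm (hl _ hxs.2) ?_
      have := (h xs hxs.1 l hl).1
      simp only [lagrangian] at this
      linarith
    refine ⟨hl, hcs, fun v hv => ?_⟩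
    obtain ⟨D, hD⟩ := exists_hasDirDeriv hL xs v
    refine ⟨D, hD, hasDirDeriv_nonneg_of_isMinOn hL.locallyLipschitz (fun z hz => ?_) hv hD⟩
    have := (h z hz l hl).1
    simpa only [lagrangian, hcs, add_zero] using this

lemma IsGlobalSaddlePoint.isGloballyOptimal (hxs : xs ∈ feasibleSet A K G)
    {l : StrongDual ℝ Y} (hl : l ∈ polarCone K) (h : IsGlobalSaddlePoint A K f G xs l) :
    IsGloballyOptimal A K f G xs := by
  refine ⟨hxs, fun z hz => ?_⟩
  have h1 := (h z hz.1 l hl).1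
  have h2 := hl _ hz.2
  simp only [lagrangian] at h1
  linarith

/-- `G` need not be continuous away from `U`, but each `l ∘ G` with `l` polar is convex on a
finite-dimensional space, hence continuous; the bipolar theorem reduces membership in `K` to these
scalar conditions. -/
lemma isClosed_sub_mem_cone (hne : (K : Set Y).Nonempty) (hK : IsClosed (K : Set Y))
    (hG : IsNegConeConvex K G) :
    IsClosed {p : EuclideanSpace ℝ (Fin d) × Y | G p.1 - p.2 ∈ K} := by
  have e : {p : EuclideanSpace ℝ (Fin d) × Y | G p.1 - p.2 ∈ K} =
      ⋂ l ∈ polarCone K, {p | l (G p.1) - l p.2 ≤ 0} := by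
    ext p
    simp [mem_iff_forall_polarCone hne hK]
  rw [e]
  refine isClosed_biInter fun l hl => isClosed_le ?_ continuous_const
  have := (convexOn_polar_comp hG hl).locallyLipschitz.continuous
  exact (this.comp continuous_fst).sub (l.continuous.comp continuous_snd)

/-- The perturbations `y` for which some `x ∈ A` of norm at most `r` satisfies `G x - y ∈ K` and
has objective value at most `r`. -/
def boundedPerturbations (A : Set (EuclideanSpace ℝ (Fin d))) (K : ConvexCone ℝ Y)
    (f : EuclideanSpace ℝ (Fin d) → W → ℝ) (G : EuclideanSpace ℝ (Fin d) → Y) (r : ℝ) : Set Y :=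
  {y | ∃ x ∈ A, ‖x‖ ≤ r ∧ objective f x ≤ r ∧ G x - y ∈ K}

/-- The admissible `x` form a compact set, and projection along a compact factor is a closed map. -/
lemma isClosed_boundedPerturbations (hA : IsClosed A) (hne : (K : Set Y).Nonempty)
    (hK : IsClosed (K : Set Y)) (hF : ConvexOn ℝ univ (objective f))
    (hG : IsNegConeConvex K G) (r : ℝ) : IsClosed (boundedPerturbations A K f G r) := by
  have hC : IsCompact (Metric.closedBall (0 : EuclideanSpace ℝ (Fin d)) r ∩
      (A ∩ {x | objective f x ≤ r})) :=
    (isCompact_closedBall _ _).inter_right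
      (hA.inter (isClosed_le hF.locallyLipschitz.continuous continuous_const))
  have := isCompact_iff_compactSpace.1 hC
  have hcl := isClosedMap_snd_of_compactSpace _
    ((isClosed_sub_mem_cone hne hK hG).preimage
      (continuous_subtype_val.prodMap continuous_id :
        Continuous (Prod.map (Subtype.val : (Metric.closedBall (0 : EuclideanSpace ℝ (Fin d)) r ∩
          (A ∩ {x | objective f x ≤ r}) : Set _) → _) (id : Y → Y))))
  convert hcl using 1
  ext y
  constructor
  · rintro ⟨x, hxA, hxr, hfx, hy⟩
    exact ⟨(⟨x, by simpa using hxr, hxA, hfx⟩, y), hy, rfl⟩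
  · rintro ⟨⟨⟨x, hxr, hxA, hfx⟩, y⟩, hy, rfl⟩
    exact ⟨x, hxA, by simpa using hxr, hfx, hy⟩

/-- Under Slater's condition the perturbations attained with bounded data have interior points. -/
lemma exists_interior_boundedPerturbations_nonempty [CompleteSpace Y] (hA : IsClosed A)
    (hne : (K : Set Y).Nonempty) (hK : IsClosed (K : Set Y))
    (hF : ConvexOn ℝ univ (objective f)) (hG : IsNegConeConvex K G)
    (hS : SlaterCondition A K G) :
    ∃ r, (interior (boundedPerturbations A K f G r)).Nonempty := by
  let V : Set Y := interior (G '' A - (K : Set Y))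
  -- The index `none` adds the closed set `Vᶜ`, so that the family covers all of `Y` and Baire
  -- applies; a point of `V` cannot lie in its interior.
  let S : Option ℕ → Set Y := fun n => n.elim Vᶜ fun n => boundedPerturbations A K f G n
  have hcl : ∀ n, IsClosed (S n) := by
    rintro (_ | n)
    · exact isOpen_interior.isClosed_compl
    · exact isClosed_boundedPerturbations hA hne hK hF hG n
  have hcov : ⋃ n, S n = univ := by
    refine eq_univ_of_forall fun y => mem_iUnion.2 ?_
    by_cases hy : y ∈ V
    · obtain ⟨_, ⟨x, hx, rfl⟩, k, hk, rfl⟩ := interior_subset hy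
      obtain ⟨n, hn⟩ := exists_nat_ge (max ‖x‖ (objective f x))
      exact ⟨some n, x, hx, (le_max_left _ _).trans hn, (le_max_right _ _).trans hn, by simpa⟩
    · exact ⟨none, hy⟩
  obtain ⟨y, hyV, hy⟩ := (dense_iUnion_interior_of_closed hcl hcov).inter_open_nonempty V
    isOpen_interior ⟨0, hS⟩
  obtain ⟨_ | n, hn⟩ := mem_iUnion.1 hy
  · exact absurd hyV (interior_subset hn)
  · exact ⟨n, y, hn⟩

/-- The strict epigraph of the optimal value of the perturbed problem, relative to the objective
value at `xs`. -/
def valueEpigraph (A : Set (EuclideanSpace ℝ (Fin d))) (K : ConvexCone ℝ Y)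
    (f : EuclideanSpace ℝ (Fin d) → W → ℝ) (G : EuclideanSpace ℝ (Fin d) → Y)
    (xs : EuclideanSpace ℝ (Fin d)) : Set (Y × ℝ) :=
  {p | ∃ x ∈ A, objective f x - objective f xs < p.2 ∧ G x - p.1 ∈ K}

lemma convex_valueEpigraph (hA : Convex ℝ A) (h0 : (0 : Y) ∈ K)
    (hF : ConvexOn ℝ univ (objective f)) (hG : IsNegConeConvex K G) :
    Convex ℝ (valueEpigraph A K f G xs) := by
  rintro ⟨y₁, t₁⟩ ⟨x₁, hx₁, ht₁, hy₁⟩ ⟨y₂, t₂⟩ ⟨x₂, hx₂, ht₂, hy₂⟩ a b ha hb hab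
  refine ⟨a • x₁ + b • x₂, hA hx₁ hx₂ ha hb hab, ?_, ?_⟩
  · have hc := hF.2 (mem_univ x₁) (mem_univ x₂) ha hb hab
    simp only [smul_eq_mul, Prod.smul_mk, Prod.mk_add_mk] at hc ht₁ ht₂ ⊢
    have hpos : 0 < a * (t₁ - (objective f x₁ - objective f xs)) +
        b * (t₂ - (objective f x₂ - objective f xs)) := by
      rcases ha.eq_or_lt with rfl | ha
      · obtain rfl : b = 1 := by linarith
        linarith
      · have := mul_pos ha (sub_pos.2 ht₁)
        have := mul_nonneg hb (sub_pos.2 ht₂).le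
        linarith
    have e : objective f xs = a * objective f xs + b * objective f xs := by
      rw [← add_mul, hab, one_mul]
    linarith
  · obtain rfl : b = 1 - a := by linarith
    have hk := K.add_mem (hG x₁ x₂ a ⟨ha, by linarith⟩)
      (K.add_mem (smul_mem_of_nonneg h0 ha hy₁) (smul_mem_of_nonneg h0 hb hy₂))
    convert hk using 1
    simp only [Prod.smul_mk, Prod.mk_add_mk]
    module

lemma interior_valueEpigraph_nonempty {r : ℝ}
    (h : (interior (boundedPerturbations A K f G r)).Nonempty) :
    (interior (valueEpigraph A K f G xs)).Nonempty := by
  obtain ⟨y, hy⟩ := h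
  refine ⟨(y, r - objective f xs + 1), mem_interior.2
    ⟨interior (boundedPerturbations A K f G r) ×ˢ Ioi (r - objective f xs), ?_,
      isOpen_interior.prod isOpen_Ioi, hy, ?_⟩⟩
  · rintro ⟨z, t⟩ ⟨hz, ht⟩
    obtain ⟨x, hx, -, hfx, hk⟩ := interior_subset hz
    exact ⟨x, hx, lt_of_le_of_lt (by linarith) (mem_Ioi.1 ht), hk⟩
  · simp

/-- The convex multiplier rule: an optimal solution is part of a saddle point under Slater's
condition. -/
theorem exists_isGlobalSaddlePoint [CompleteSpace Y] (hAcl : IsClosed A) (hA : Convex ℝ A)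
    (hne : (K : Set Y).Nonempty) (hK : IsClosed (K : Set Y))
    (hF : ConvexOn ℝ univ (objective f)) (hG : IsNegConeConvex K G)
    (hopt : IsGloballyOptimal A K f G xs) (hS : SlaterCondition A K G) :
    ∃ l ∈ polarCone K, IsGlobalSaddlePoint A K f G xs l := by
  have h0 := zero_mem_of_isClosed hne hK
  obtain ⟨r, hr⟩ := exists_interior_boundedPerturbations_nonempty hAcl hne hK hF hG hS
  have hint : (interior (valueEpigraph A K f G xs)).Nonempty :=
    interior_valueEpigraph_nonempty hr
  have hconv : Convex ℝ (valueEpigraph A K f G xs) := convex_valueEpigraph hA h0 hF hG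
  have hnot : (0 : Y × ℝ) ∉ interior (valueEpigraph A K f G xs) := fun h => by
    obtain ⟨x, hx, ht, hk⟩ := interior_subset h
    have := hopt.2 x ⟨hx, by simpa using hk⟩
    simp only [Prod.snd_zero] at ht
    linarith
  obtain ⟨φ, hφ⟩ := geometric_hahn_banach_open_point hconv.interior isOpen_interior hnot
  simp only [map_zero] at hφ
  -- A convex set with nonempty interior lies in the closure of that interior.
  have hle : ∀ p ∈ valueEpigraph A K f G xs, φ p ≤ 0 := fun p hp => by
    have hp' := subset_closure hp
    rw [← hconv.closure_interior_eq_closure_of_nonempty_interior hint] at hp'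
    exact closure_minimal (t := {q | φ q ≤ 0}) (fun q hq => (hφ q hq).le)
      (isClosed_le φ.continuous continuous_const) hp'
  let ℓ : StrongDual ℝ Y := φ.comp (ContinuousLinearMap.inl ℝ Y ℝ)
  let μ : ℝ := φ (0, 1)
  have hsplit : ∀ y t, φ (y, t) = ℓ y + t * μ := fun y t => by
    have e : ((y, t) : Y × ℝ) = (y, 0) + t • (0, 1) := by simp
    rw [e, map_add, map_smul]
    rfl
  have hineq : ∀ x ∈ A, ∀ k ∈ K, ∀ t, objective f x - objective f xs < t →
      ℓ (G x) - ℓ k + t * μ ≤ 0 := fun x hx k hk t ht => by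
    have := hle (G x - k, t) ⟨x, hx, ht, by simpa using hk⟩
    rwa [hsplit, map_sub] at this
  have hμ0 : μ ≤ 0 := by
    by_contra! hpos
    have hxs := hopt.1
    have := hineq xs hxs.1 _ hxs.2 1 (by simp)
    simp only [sub_self] at this
    linarith
  have hμ : μ < 0 := by
    -- If `μ = 0`, then `ℓ ≤ 0` near `0` by Slater's condition, so `ℓ = 0` by scaling and symmetry,
    -- against `φ < 0` on the interior.
    refine hμ0.lt_of_ne fun hμ => ?_
    have hloc : ∀ y ∈ G '' A - (K : Set Y), ℓ y ≤ 0 := by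
      rintro _ ⟨_, ⟨x, hx, rfl⟩, k, hk, rfl⟩
      have := hineq x hx k hk _ (lt_add_one _)
      rw [hμ] at this
      simp only [map_sub]
      linarith
    have hzero : ∀ y, ℓ y ≤ 0 := fun y => by
      have ht : Tendsto (fun s : ℝ => s • y) (𝓝[>] 0) (𝓝 0) := by
        have : Tendsto (fun s : ℝ => s • y) (𝓝 0) (𝓝 ((0 : ℝ) • y)) :=
          tendsto_id.smul_const y
        rw [zero_smul] at this
        exact this.mono_left nhdsWithin_le_nhds
      have hev : ∀ᶠ s : ℝ in 𝓝[>] 0, s • y ∈ G '' A - (K : Set Y) :=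
        ht.eventually (mem_interior_iff_mem_nhds.1 hS)
      obtain ⟨s, hs, hs0⟩ := (hev.and self_mem_nhdsWithin).exists
      have := hloc _ hs
      rw [map_smul, smul_eq_mul] at this
      exact nonpos_of_mul_nonpos_right this hs0
    obtain ⟨⟨y, t⟩, hp⟩ := hint
    have h1 := hφ _ hp
    have h2 := hzero (-y)
    rw [hsplit, hμ] at h1
    rw [map_neg] at h2
    linarith
  have hmain : ∀ x ∈ A, ∀ k ∈ K,
      objective f xs + (μ⁻¹ • ℓ) k ≤ objective f x + (μ⁻¹ • ℓ) (G x) := fun x hx k hk => by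
    have hlim : ℓ (G x) - ℓ k + (objective f x - objective f xs) * μ ≤ 0 := by
      have ht : Tendsto (fun t : ℝ => ℓ (G x) - ℓ k + t * μ)
          (𝓝[>] (objective f x - objective f xs))
          (𝓝 (ℓ (G x) - ℓ k + (objective f x - objective f xs) * μ)) :=
        (Continuous.tendsto (by fun_prop) _).mono_left nhdsWithin_le_nhds
      refine le_of_tendsto ht ?_
      filter_upwards [self_mem_nhdsWithin] with t ht using hineq x hx k hk t ht
    have := mul_nonneg_of_nonpos_of_nonpos (inv_lt_zero.2 hμ).le hlim
    have e : μ⁻¹ * (ℓ (G x) - ℓ k + (objective f x - objective f xs) * μ) =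
        μ⁻¹ * ℓ (G x) - μ⁻¹ * ℓ k + (objective f x - objective f xs) := by
      field_simp [hμ.ne]
    rw [e] at this
    simp only [_root_.smul_apply, smul_eq_mul]
    linarith
  -- In `hmain`, `x = xs` bounds the functional above on `K`, forcing it into the polar cone, and `k
  -- = 0` is the saddle inequality.
  refine ⟨μ⁻¹ • ℓ, nonpos_of_bddAbove_on_cone (u := (μ⁻¹ • ℓ) (G xs)) fun k hk => ?_,
    fun z hz m hm => ⟨?_, ?_⟩⟩
  · linarith [hmain xs hopt.1.1 k hk]
  · simpa [lagrangian] using hmain z hz 0 h0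
  · have := hm _ hopt.1.2
    simp only [lagrangian]
    linarith

end Problem

end ConeMinimax

/-- The smoothness of `f` and `G` is only required on a neighbourhood `U` of `xs`. The hypothesis
`hmax` says that the maximum that defines the objective exists at every point; it holds
automatically when every `f x` is continuous on the compact space `W`. -/
theorem mainTheorem8 {d : ℕ}
    {W : Type*} [TopologicalSpace W] [CompactSpace W] [T2Space W] [Nonempty W]
    {Y : Type*} [NormedAddCommGroup Y] [NormedSpace ℝ Y] [CompleteSpace Y]
    (A : Set (EuclideanSpace ℝ (Fin d))) (hAclosed : IsClosed A) (hAconvex : Convex ℝ A)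
    (K : ConvexCone ℝ Y) (hKne : (K : Set Y).Nonempty) (hKclosed : IsClosed (K : Set Y))
    (f : EuclideanSpace ℝ (Fin d) → W → ℝ) (G : EuclideanSpace ℝ (Fin d) → Y)
    (xs : EuclideanSpace ℝ (Fin d)) (hxs : xs ∈ ConeMinimax.feasibleSet A K G)
    (U : Set (EuclideanSpace ℝ (Fin d))) (hUopen : IsOpen U) (hxsU : xs ∈ U)
    (hmax : ∀ x, ∃ ω, ∀ ω', f x ω' ≤ f x ω)
    (hfcont : ContinuousOn (fun p : EuclideanSpace ℝ (Fin d) × W => f p.1 p.2) (U ×ˢ univ))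
    (hfdiff : ∀ ω, ∀ x ∈ U, DifferentiableAt ℝ (fun z => f z ω) x)
    (hfgrad : ContinuousOn
      (fun p : EuclideanSpace ℝ (Fin d) × W => gradient (fun z => f z p.2) p.1) (U ×ˢ univ))
    (hG : ContDiffOn ℝ 1 G U)
    (hfconvex : ∀ ω, ConvexOn ℝ univ (fun x => f x ω))
    (hGconvex : ConeMinimax.IsNegConeConvex K G) :
    (∀ ls ∈ ConeMinimax.polarCone K,
      (ConeMinimax.IsLagrangeMultiplier A K f G xs ls ↔
        ConeMinimax.IsGlobalSaddlePoint A K f G xs ls)) ∧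
    ((∃ ls, ConeMinimax.IsLagrangeMultiplier A K f G xs ls) →
      ConeMinimax.IsGloballyOptimal A K f G xs) ∧
    (ConeMinimax.IsGloballyOptimal A K f G xs → ConeMinimax.SlaterCondition A K G →
      ∃ ls, ConeMinimax.IsLagrangeMultiplier A K f G xs ls) := by
  have hF := ConeMinimax.convexOn_objective hmax hfconvex
  have hiff : ∀ ls ∈ ConeMinimax.polarCone K, (ConeMinimax.IsLagrangeMultiplier A K f G xs ls ↔
      ConeMinimax.IsGlobalSaddlePoint A K f G xs ls) := fun ls hls =>
    ConeMinimax.isLagrangeMultiplier_iff_isGlobalSaddlePoint hAconvex hxs hF hGconvex hls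
  refine ⟨hiff, ?_, fun hopt hS => ?_⟩
  · rintro ⟨ls, hls⟩
    exact ((hiff ls hls.1).1 hls).isGloballyOptimal hxs hls.1
  · obtain ⟨ls, hls, hsaddle⟩ := ConeMinimax.exists_isGlobalSaddlePoint hAclosed hAconvex hKne
      hKclosed hF hGconvex hopt hS
    exact ⟨ls, (hiff ls hls).2 hsaddle⟩
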